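/- Let $\mathcal O$ be a complete discrete valuation ring with fraction field of characteristic $0$ and finite residue field $k$ of cardinality $q=p^h$, $p$ prime, and fix a uniformizer $\pi$ of $\mathcal O$. For an $\mathcal O$-algebra $B$ let $W_{\mathcal O}(B)$ be the $\mathcal O$-algebra of ramified Witt vectors: the set $B^{\mathbb N_0}$ with the $\mathcal O$-algebra structure, functorial in $B$, for which the maps $\Phi_n\colon W_{\mathcal O}(B)\to B$, $\Phi_n(b_0,b_1,\dots)=b_0^{q^n}+\pi b_1^{q^{n-1}}+\dots+\pi^n b_n$ $(n\ge 0)$, are homomorphisms of $\mathcal O$-algebras. Let $W(B)$ be the ring of $p$-typical Witt vectors, with Witt polynomials $w_n(b_0,b_1,\dots)=b_0^{p^n}+p\,b_1^{p^{n-1}}+\dots+p^n b_n$, and let $u_B\colon W(B)\to W_{\mathcal O}(B)$ be Drinfeld's map, i.e. the ring homomorphism, functorial in the $\mathcal O$-algebra $B$, such that $\Phi_n(u_B(\boldsymbol b))=w_{nh}(\boldsymbol b)$ for all $n\ge 0$ and $\boldsymbol b\in W(B)$. Regard $\mathcal O$ as a $W(k)$-algebra via the unique ring homomorphism $W(k)\to\mathcal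 O$ that induces the identity on the residue field $k$. For a $k$-algebra $A$ (an $\mathcal O$-algebra via $\mathcal O\to k$) the map $u_A$ is $W(k)$-linear; let \[ r_A\colon W(A)\otimes_{W(k)}\mathcal O\to W_{\mathcal O}(A),\qquad x\otimes c\mapsto c\cdot u_A(x), \] be the induced homomorphism of $\mathcal O$-algebras. Then for every $k$-algebra $A$: (1) if $A$ is reduced, then $r_A$ is injective; (2) if $A$ is semiperfect, i.e. the Frobenius $a\mapsto a^p$ of $A$ is surjective, then $r_A$ is surjective; (3) if $A$ is perfect, i.e. the Frobenius of $A$ is bijective, then $r_A$ is bijective. In particular, the structure map $\mathcal O\to W_{\mathcal O}(k)$ is an isomorphism. -/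

import Mathlib

open IsLocalRing

/-! ## Ghost components and Dwork's lemma -/

section Ghost

variable {P : Type*} [CommRing P]

/-- The ghost components `Φ_n(b) = b_0^(q^n) + ϖ b_1^(q^(n-1)) + ⋯ + ϖ^n b_n` of a sequence. -/
def ghostSeq (ϖ : P) (q : ℕ) (b : ℕ → P) (n : ℕ) : P :=
  ∑ i ∈ Finset.range (n + 1), ϖ ^ i * b i ^ q ^ (n - i)

/-- The sequence obtained by solving `Φ_n(b) = a_n` recursively for `b_n`.
It does solve these equations under the congruences of `ghostSeq_ghostLift`,
and the solution is unique if `ϖ` is not a zero divisor (`ghostSeq_injective`). -/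
noncomputable def ghostLift (ϖ : P) (q : ℕ) (a : ℕ → P) : ℕ → P
  | n => Classical.epsilon fun c : P =>
      a n = ∑ i : Fin n, ϖ ^ (i : ℕ) * ghostLift ϖ q a i ^ q ^ (n - (i : ℕ)) + ϖ ^ n * c

theorem dvd_pow_sub_pow {ϖ a b : P} {t : ℕ} (ht : ϖ ∣ (t : P)) (h : ϖ ∣ a - b) (n : ℕ) :
    ϖ ^ (n + 1) ∣ a ^ t ^ n - b ^ t ^ n := by
  have := SModEq.pow_pow_add_one (I := Ideal.span {ϖ}) (p := t)
    (Ideal.mem_span_singleton.2 ht) (x := a) (y := b)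
    (SModEq.sub_mem.2 (Ideal.mem_span_singleton.2 h)) n
  rw [SModEq.sub_mem, Ideal.span_singleton_pow, Ideal.mem_span_singleton] at this
  exact this

theorem ghostSeq_eq_add (ϖ : P) (q : ℕ) (b : ℕ → P) (n : ℕ) :
    ghostSeq ϖ q b n =
      ∑ i ∈ Finset.range n, ϖ ^ i * b i ^ q ^ (n - i) + ϖ ^ n * b n := by
  simp [ghostSeq, Finset.sum_range_succ]

theorem ghostSeq_ghostLift {ϖ : P} {q : ℕ} (hq : ϖ ∣ (q : P)) (σ : P →+* P) (hϖ : σ ϖ = ϖ)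
    (hσ : ∀ b, ϖ ∣ σ b - b ^ q) {a : ℕ → P}
    (ha : ∀ n, ϖ ^ (n + 1) ∣ σ (a n) - a (n + 1)) (n : ℕ) :
    ghostSeq ϖ q (ghostLift ϖ q a) n = a n := by
  have key : ∀ n, (∃ c, a n = ∑ i : Fin n,
      ϖ ^ (i : ℕ) * ghostLift ϖ q a i ^ q ^ (n - (i : ℕ)) + ϖ ^ n * c) →
      ghostSeq ϖ q (ghostLift ϖ q a) n = a n := by
    intro n h
    rw [ghostSeq_eq_add, ← Fin.sum_univ_eq_sum_range
      (fun i => ϖ ^ i * ghostLift ϖ q a i ^ q ^ (n - i)) n]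
    have := Classical.epsilon_spec h
    rw [← ghostLift] at this
    exact this.symm
  induction n with
  | zero => exact key 0 ⟨a 0, by simp⟩
  | succ n ih =>
    apply key
    suffices h : ϖ ^ (n + 1) ∣ a (n + 1) - ∑ i : Fin (n + 1),
        ϖ ^ (i : ℕ) * ghostLift ϖ q a i ^ q ^ (n + 1 - (i : ℕ)) by
      obtain ⟨c, hc⟩ := h
      exact ⟨c, by rw [← hc]; ring⟩
    rw [Fin.sum_univ_eq_sum_range (fun i => ϖ ^ i * ghostLift ϖ q a i ^ q ^ (n + 1 - i)) (n + 1)]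
    have h1 : ϖ ^ (n + 1) ∣ σ (a n) - ∑ i ∈ Finset.range (n + 1),
        ϖ ^ i * ghostLift ϖ q a i ^ q ^ (n + 1 - i) := by
      rw [← ih, ghostSeq, map_sum, ← Finset.sum_sub_distrib]
      refine Finset.dvd_sum fun i hi => ?_
      have hi' : i ≤ n := Nat.lt_succ_iff.1 (Finset.mem_range.1 hi)
      have e1 : n + 1 = i + (n - i + 1) := by omega
      have e2 : n + 1 - i = 1 + (n - i) := by omega
      rw [map_mul, map_pow, map_pow, hϖ, ← mul_sub, e2, pow_add q, pow_one, pow_mul]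
      nth_rw 1 [e1]
      rw [pow_add ϖ i]
      exact mul_dvd_mul_left _ (dvd_pow_sub_pow hq (hσ _) _)
    have := dvd_sub h1 (ha n)
    rwa [show σ (a n) - (∑ i ∈ Finset.range (n + 1),
      ϖ ^ i * ghostLift ϖ q a i ^ q ^ (n + 1 - i)) - (σ (a n) - a (n + 1)) =
      a (n + 1) - ∑ i ∈ Finset.range (n + 1),
        ϖ ^ i * ghostLift ϖ q a i ^ q ^ (n + 1 - i) by ring] at this

theorem ghostSeq_injective {ϖ : P} (hϖ : ∀ x : P, ϖ * x = 0 → x = 0) (q : ℕ) :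
    Function.Injective (ghostSeq ϖ q) := by
  have hpow : ∀ (n : ℕ) (x : P), ϖ ^ n * x = 0 → x = 0 := by
    intro n
    induction n with
    | zero => intro x h; simpa using h
    | succ n ih => intro x h; rw [pow_succ, mul_assoc] at h; exact hϖ _ (ih _ h)
  intro b c h
  funext n
  induction n using Nat.strong_induction_on with
  | _ n ih =>
    have hn := congrFun h n
    rw [ghostSeq_eq_add, ghostSeq_eq_add, Finset.sum_congr rfl
      (fun i hi => by rw [ih i (Finset.mem_range.1 hi)])] at hn
    exact sub_eq_zero.1 (hpow n _ (by rw [mul_sub]; exact sub_eq_zero.2 (add_left_cancel hn)))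

/-- Sequences whose ghost components agree modulo `ϖ^(n+1)` agree modulo `ϖ`. -/
theorem dvd_sub_of_ghostSeq [IsDomain P] {ϖ : P} (hϖ : ϖ ≠ 0) {q : ℕ} (hq : ϖ ∣ (q : P))
    {b c : ℕ → P} (h : ∀ n, ϖ ^ (n + 1) ∣ ghostSeq ϖ q b n - ghostSeq ϖ q c n) (n : ℕ) :
    ϖ ∣ b n - c n := by
  induction n using Nat.strong_induction_on with
  | _ n ih =>
    have h1 : ϖ ^ (n + 1) ∣ ∑ i ∈ Finset.range n, ϖ ^ i * b i ^ q ^ (n - i) -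
        ∑ i ∈ Finset.range n, ϖ ^ i * c i ^ q ^ (n - i) := by
      rw [← Finset.sum_sub_distrib]
      refine Finset.dvd_sum fun i hi => ?_
      have hi' := Finset.mem_range.1 hi
      rw [← mul_sub, show n + 1 = i + (n - i + 1) by omega, pow_add ϖ i]
      exact mul_dvd_mul_left _ (dvd_pow_sub_pow hq (ih i hi') _)
    have h2 := dvd_sub (h n) h1
    rw [ghostSeq_eq_add, ghostSeq_eq_add, show ∀ s t x y : P, s + x - (t + y) - (s - t) = x - y by
      intros; ring, ← mul_sub, pow_succ] at h2
    exact (mul_dvd_mul_iff_left (pow_ne_zero n hϖ)).1 h2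

theorem map_ghostSeq {Q : Type*} [CommRing Q] (f : P →+* Q) (ϖ : P) (q : ℕ) (b : ℕ → P) (n : ℕ) :
    f (ghostSeq ϖ q b n) = ghostSeq (f ϖ) q (fun i => f (b i)) n := by
  simp [ghostSeq]

end Ghost

/-! ## Arithmetic of a discrete valuation ring with finite residue field -/

section Residue

variable {O : Type*} [CommRing O] [IsDomain O] [IsDiscreteValuationRing O]

/-- The number of elements of the residue field. -/
noncomputable def residueCard (O : Type*) [CommRing O] [IsLocalRing O] : ℕ :=
  Nat.card (ResidueField O)

theorem residueCard_pos (O : Type*) [CommRing O] [IsLocalRing O] [Finite (ResidueField O)] :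
    0 < residueCard O := Nat.card_pos

/-- The number `h` such that the residue field has `p ^ h` elements. -/
noncomputable def residueDegree (O : Type*) [CommRing O] [IsLocalRing O] (p : ℕ) : ℕ :=
  Nat.log p (residueCard O)

theorem dvd_iff_residue_eq_zero {π : O} (hπ : Irreducible π) (x : O) :
    π ∣ x ↔ residue O x = 0 := by
  rw [residue_eq_zero_iff, hπ.maximalIdeal_eq, Ideal.mem_span_singleton]

theorem exists_residueCard_eq (O : Type*) [CommRing O] [IsLocalRing O]
    [Finite (ResidueField O)] (p : ℕ) [Fact p.Prime] [CharP (ResidueField O) p] :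
    ∃ n, 0 < n ∧ residueCard O = p ^ n := by
  have := Fintype.ofFinite (ResidueField O)
  obtain ⟨n, -, hn⟩ := FiniteField.card (ResidueField O) p
  exact ⟨n, n.pos, by rw [residueCard, Nat.card_eq_fintype_card, hn]⟩

theorem residueCard_eq (O : Type*) [CommRing O] [IsLocalRing O]
    [Finite (ResidueField O)] (p : ℕ) [hp : Fact p.Prime] [CharP (ResidueField O) p] :
    residueCard O = p ^ residueDegree O p := by
  obtain ⟨n, -, hn⟩ := exists_residueCard_eq O p
  rw [residueDegree, hn, Nat.log_pow hp.out.one_lt]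

theorem residueDegree_pos (O : Type*) [CommRing O] [IsLocalRing O]
    [Finite (ResidueField O)] (p : ℕ) [hp : Fact p.Prime] [CharP (ResidueField O) p] :
    0 < residueDegree O p := by
  obtain ⟨n, h, hn⟩ := exists_residueCard_eq O p
  rwa [residueDegree, hn, Nat.log_pow hp.out.one_lt]

theorem dvd_prime {π : O} (hπ : Irreducible π) (p : ℕ) [CharP (ResidueField O) p] :
    π ∣ (p : O) := by
  rw [dvd_iff_residue_eq_zero hπ, map_natCast, CharP.cast_eq_zero]

theorem dvd_residueCard [Finite (ResidueField O)] {π : O} (hπ : Irreducible π) : π ∣ (residueCard O : O) := by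
  have := Fintype.ofFinite (ResidueField O)
  rw [dvd_iff_residue_eq_zero hπ, map_natCast, residueCard, Nat.card_eq_fintype_card,
    Nat.cast_card_eq_zero]

theorem dvd_sub_pow_residueCard [Finite (ResidueField O)] {π : O} (hπ : Irreducible π) (x : O) :
    π ∣ x - x ^ residueCard O := by
  have := Fintype.ofFinite (ResidueField O)
  rw [dvd_iff_residue_eq_zero hπ, map_sub, map_pow, residueCard, Nat.card_eq_fintype_card,
    FiniteField.pow_card, sub_self]

open MvPolynomial in
/-- On a polynomial ring over `O`, the endomorphism `X_i ↦ X_i ^ q` lifts the `q`-Frobenius. -/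
theorem dvd_expand_sub_pow [Finite (ResidueField O)] {π : O} (hπ : Irreducible π) {ι : Type*} (f : MvPolynomial ι O) :
    algebraMap O (MvPolynomial ι O) π ∣ expand (residueCard O) f - f ^ residueCard O := by
  obtain ⟨p, hchar⟩ := CharP.exists (ResidueField O)
  have : Fact p.Prime := ⟨CharP.char_is_prime (ResidueField O) p⟩
  obtain ⟨n, -, hn⟩ := exists_residueCard_eq O p
  induction f using MvPolynomial.induction_on with
  | C a =>
    rw [expand_C, ← C_pow, ← C_sub, algebraMap_eq]
    exact map_dvd C (dvd_sub_pow_residueCard hπ a)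
  | add f g hf hg =>
    obtain ⟨r, hr⟩ := exists_add_pow_prime_pow_eq (R := MvPolynomial ι O)
      (Fact.out : p.Prime) f g n
    have hp : algebraMap O (MvPolynomial ι O) π ∣ (p : MvPolynomial ι O) := by
      rw [← map_natCast (algebraMap O (MvPolynomial ι O))]
      exact map_dvd _ (dvd_prime hπ p)
    rw [hn] at hf hg ⊢
    rw [map_add, hr, show ∀ a b c d e : MvPolynomial ι O,
      a + b - (c + d + e) = (a - c) + (b - d) - e by intros; ring]
    refine dvd_sub (dvd_add hf hg) ?_
    rw [mul_assoc, mul_assoc]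
    exact hp.mul_right _
  | mul_X f i hf =>
    rw [map_mul, expand_X, mul_pow, ← sub_mul]
    exact hf.mul_right _

theorem mvPolynomial_eq_zero_of_mul {π : O} (hπ : Irreducible π) {ι : Type*}
    (x : MvPolynomial ι O) (h : algebraMap O (MvPolynomial ι O) π * x = 0) : x = 0 := by
  refine (mul_eq_zero.1 h).resolve_left fun h0 => hπ.ne_zero ?_
  exact MvPolynomial.C_injective ι O (by simpa using h0)

theorem ghostSeq_ghostLift_mvPolynomial [Finite (ResidueField O)] {π : O} (hπ : Irreducible π) {ι : Type*}
    {a : ℕ → MvPolynomial ι O}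
    (ha : ∀ n, algebraMap O (MvPolynomial ι O) π ^ (n + 1) ∣
      MvPolynomial.expand (residueCard O) (a n) - a (n + 1)) (n : ℕ) :
    ghostSeq (algebraMap O _ π) (residueCard O)
      (ghostLift (algebraMap O _ π) (residueCard O) a) n = a n := by
  have h1 : algebraMap O (MvPolynomial ι O) π ∣ (residueCard O : MvPolynomial ι O) := by
    rw [← map_natCast (algebraMap O (MvPolynomial ι O))]
    exact map_dvd _ (dvd_residueCard hπ)
  have h2 : ((MvPolynomial.expand (residueCard O) : MvPolynomial ι O →ₐ[O] MvPolynomial ι O) :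
      MvPolynomial ι O →+* MvPolynomial ι O)
      (algebraMap O _ π) = algebraMap O _ π := (MvPolynomial.expand _).commutes π
  exact ghostSeq_ghostLift h1 _ h2 (dvd_expand_sub_pow hπ) ha n

end Residue

/-! ## Ramified Witt vectors -/

/-- The set `B^ℕ` underlying the ramified Witt vectors over `O` (with uniformizer `π`) with
coefficients in `B`. -/
@[ext]
structure RamifiedWittVector {O : Type*} (π : O) (B : Type*) where
  coeff : ℕ → B

namespace RamifiedWittVector

variable {O : Type*} [CommRing O] [IsDomain O] [IsDiscreteValuationRing O] (π : O)

/-- The ghost component `Φ_n(b) = b_0^(q^n) + π b_1^(q^(n-1)) + ⋯ + π^n b_n`, where `q` is the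
cardinality of the residue field of `O`. -/
noncomputable def ghost {π : O} {B : Type*} [CommRing B] [Algebra O B]
    (b : RamifiedWittVector π B) (n : ℕ) : B :=
  ghostSeq (algebraMap O B π) (residueCard O) b.coeff n

/-- The ghost components of the generic vector with coordinates `X (f 0), X (f 1), …`. -/
noncomputable def genericGhost {ι : Type*} (f : ℕ → ι) (n : ℕ) : MvPolynomial ι O :=
  ghostSeq (algebraMap O _ π) (residueCard O) (fun i => MvPolynomial.X (f i)) n

/-- The polynomials over `O` whose ghost components are the given ones. -/
noncomputable def structurePoly {ι : Type*} (a : ℕ → MvPolynomial ι O) : ℕ → MvPolynomial ι O :=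
  ghostLift (algebraMap O _ π) (residueCard O) a

/-- The polynomials giving the sum of two vectors, determined by
`Φ_n(S_0, S_1, …) = Φ_n(X) + Φ_n(Y)`. -/
noncomputable def addPoly : ℕ → MvPolynomial (ℕ ⊕ ℕ) O :=
  structurePoly π fun n => genericGhost π Sum.inl n + genericGhost π Sum.inr n

/-- The polynomials giving the product of two vectors, determined by
`Φ_n(M_0, M_1, …) = Φ_n(X) * Φ_n(Y)`. -/
noncomputable def mulPoly : ℕ → MvPolynomial (ℕ ⊕ ℕ) O :=
  structurePoly π fun n => genericGhost π Sum.inl n * genericGhost π Sum.inr n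

/-- The polynomials giving the opposite of a vector, determined by
`Φ_n(N_0, N_1, …) = - Φ_n(X)`. -/
noncomputable def negPoly : ℕ → MvPolynomial ℕ O :=
  structurePoly π fun n => - genericGhost π id n

/-- The vector in `O^ℕ` with all ghost components equal to `c`. -/
noncomputable def constSeq (c : O) : ℕ → O :=
  ghostLift π (residueCard O) fun _ => c

section Operations

variable {π} {B : Type*} [CommRing B] [Algebra O B]

instance : Zero (RamifiedWittVector π B) := ⟨⟨fun _ => 0⟩⟩

instance : One (RamifiedWittVector π B) := ⟨⟨fun n => if n = 0 then 1 else 0⟩⟩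

noncomputable instance : Add (RamifiedWittVector π B) :=
  ⟨fun x y => ⟨fun n => MvPolynomial.aeval (Sum.elim x.coeff y.coeff) (addPoly π n)⟩⟩

noncomputable instance : Mul (RamifiedWittVector π B) :=
  ⟨fun x y => ⟨fun n => MvPolynomial.aeval (Sum.elim x.coeff y.coeff) (mulPoly π n)⟩⟩

noncomputable instance : Neg (RamifiedWittVector π B) :=
  ⟨fun x => ⟨fun n => MvPolynomial.aeval x.coeff (negPoly π n)⟩⟩

/-- The map induced on vectors by a map of coefficients. -/
def mapFun {B C : Type*} (f : B → C) (x : RamifiedWittVector π B) : RamifiedWittVector π C :=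
  ⟨fun n => f (x.coeff n)⟩

theorem mapFun_surjective {B C : Type*} {f : B → C} (hf : Function.Surjective f) :
    Function.Surjective (mapFun f : RamifiedWittVector π B → RamifiedWittVector π C) := by
  intro y
  choose g hg using hf
  exact ⟨⟨fun n => g (y.coeff n)⟩, by ext n; exact hg _⟩

variable {C : Type*} [CommRing C] [Algebra O C] (f : B →ₐ[O] C)

theorem mapFun_zero : mapFun f (0 : RamifiedWittVector π B) = 0 := by
  ext n; exact map_zero f

theorem mapFun_one : mapFun f (1 : RamifiedWittVector π B) = 1 := by
  ext n
  change f (if n = 0 then 1 else 0) = if n = 0 then 1 else 0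
  split_ifs <;> simp

theorem mapFun_add (x y : RamifiedWittVector π B) :
    mapFun f (x + y) = mapFun f x + mapFun f y := by
  ext n
  change f (MvPolynomial.aeval _ _) = MvPolynomial.aeval _ _
  rw [← AlgHom.comp_apply, MvPolynomial.comp_aeval]
  congr 2
  funext i
  cases i <;> rfl

theorem mapFun_mul (x y : RamifiedWittVector π B) :
    mapFun f (x * y) = mapFun f x * mapFun f y := by
  ext n
  change f (MvPolynomial.aeval _ _) = MvPolynomial.aeval _ _
  rw [← AlgHom.comp_apply, MvPolynomial.comp_aeval]
  congr 2
  funext i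
  cases i <;> rfl

theorem mapFun_neg (x : RamifiedWittVector π B) : mapFun f (-x) = -mapFun f x := by
  ext n
  change f (MvPolynomial.aeval _ _) = MvPolynomial.aeval _ _
  rw [← AlgHom.comp_apply, MvPolynomial.comp_aeval]
  rfl

theorem aeval_genericGhost {ι : Type*} (g : ι → B) (f : ℕ → ι) (n : ℕ) :
    MvPolynomial.aeval g (genericGhost π f n) =
      ghostSeq (algebraMap O B π) (residueCard O) (fun i => g (f i)) n := by
  have := map_ghostSeq (MvPolynomial.aeval (R := O) g : MvPolynomial ι O →+* B)
    (algebraMap O _ π) (residueCard O) (fun i => MvPolynomial.X (f i)) n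
  simpa [genericGhost] using this

theorem aeval_ghostSeq {ι : Type*} (g : ι → B) (s : ℕ → MvPolynomial ι O) (n : ℕ) :
    MvPolynomial.aeval g (ghostSeq (algebraMap O _ π) (residueCard O) s n) =
      ghostSeq (algebraMap O B π) (residueCard O) (fun i => MvPolynomial.aeval g (s i)) n := by
  have := map_ghostSeq (MvPolynomial.aeval (R := O) g : MvPolynomial ι O →+* B)
    (algebraMap O _ π) (residueCard O) s n
  simpa using this

theorem ghost_zero (n : ℕ) [Finite (ResidueField O)] :
    ghost (0 : RamifiedWittVector π B) n = 0 := by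
  rw [ghost, ghostSeq]
  refine Finset.sum_eq_zero fun i _ => ?_
  change _ * (0 : B) ^ _ = 0
  rw [zero_pow (pow_ne_zero _ (residueCard_pos O).ne'), mul_zero]

theorem ghost_one (n : ℕ) [Finite (ResidueField O)] :
    ghost (1 : RamifiedWittVector π B) n = 1 := by
  rw [ghost, ghostSeq]
  refine (Finset.sum_eq_single 0 (fun i _ hi => ?_) (by simp)).trans ?_
  · change _ * (if i = 0 then (1 : B) else 0) ^ _ = 0
    rw [if_neg hi, zero_pow (pow_ne_zero _ (residueCard_pos O).ne'), mul_zero]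
  · change _ * (if (0 : ℕ) = 0 then (1 : B) else 0) ^ _ = 1
    rw [if_pos rfl, one_pow, pow_zero, mul_one]

variable [Finite (ResidueField O)] [hπ : Fact (Irreducible π)]

theorem dvd_genericGhost {ι : Type*} (f : ℕ → ι) (n : ℕ) :
    algebraMap O (MvPolynomial ι O) π ^ (n + 1) ∣
      MvPolynomial.expand (residueCard O) (genericGhost π f n) - genericGhost π f (n + 1) := by
  have h := map_ghostSeq ((MvPolynomial.expand (residueCard O) : MvPolynomial ι O →ₐ[O] MvPolynomial ι O) :
      MvPolynomial ι O →+* MvPolynomial ι O)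
    (algebraMap O _ π) (residueCard O) (fun i => MvPolynomial.X (f i)) n
  have h' : MvPolynomial.expand (residueCard O) (genericGhost π f n) =
      ∑ i ∈ Finset.range (n + 1), algebraMap O (MvPolynomial ι O) π ^ i *
        MvPolynomial.X (f i) ^ residueCard O ^ (n + 1 - i) := by
    refine h.trans (Finset.sum_congr rfl fun i hi => ?_)
    have hi' : i ≤ n := Nat.lt_succ_iff.1 (Finset.mem_range.1 hi)
    have e : n + 1 - i = 1 + (n - i) := by omega
    have h2 : ((MvPolynomial.expand (residueCard O) : MvPolynomial ι O →ₐ[O] MvPolynomial ι O) :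
      MvPolynomial ι O →+* MvPolynomial ι O)
      (algebraMap O _ π) = algebraMap O _ π := (MvPolynomial.expand _).commutes π
    rw [h2, e, pow_add, pow_one, pow_mul]
    congr 2
    exact MvPolynomial.expand_X _ _
  rw [h', genericGhost, ghostSeq_eq_add, sub_add_cancel_left]
  exact (dvd_mul_right _ _).neg_right

theorem dvd_sub_mul {P : Type*} [CommRing P] {d a b a' b' : P} (h : d ∣ a - a')
    (h' : d ∣ b - b') : d ∣ a * b - a' * b' := by
  have : a * b - a' * b' = (a - a') * b + a' * (b - b') := by ring
  rw [this]
  exact dvd_add (h.mul_right _) (h'.mul_left _)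

theorem ghost_add (x y : RamifiedWittVector π B) (n : ℕ) :
    ghost (x + y) n = ghost x n + ghost y n := by
  refine (aeval_ghostSeq (Sum.elim x.coeff y.coeff) (addPoly π) n).symm.trans ?_
  rw [addPoly, structurePoly, ghostSeq_ghostLift_mvPolynomial hπ.out, map_add,
    aeval_genericGhost, aeval_genericGhost]
  · rfl
  · intro n
    rw [map_add, add_sub_add_comm]
    exact dvd_add (dvd_genericGhost _ n) (dvd_genericGhost _ n)

theorem ghost_mul (x y : RamifiedWittVector π B) (n : ℕ) :
    ghost (x * y) n = ghost x n * ghost y n := by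
  refine (aeval_ghostSeq (Sum.elim x.coeff y.coeff) (mulPoly π) n).symm.trans ?_
  rw [mulPoly, structurePoly, ghostSeq_ghostLift_mvPolynomial hπ.out, map_mul,
    aeval_genericGhost, aeval_genericGhost]
  · rfl
  · intro n
    rw [map_mul]
    exact dvd_sub_mul (dvd_genericGhost _ n) (dvd_genericGhost _ n)

theorem ghost_neg (x : RamifiedWittVector π B) (n : ℕ) : ghost (-x) n = -ghost x n := by
  refine (aeval_ghostSeq x.coeff (negPoly π) n).symm.trans ?_
  rw [negPoly, structurePoly, ghostSeq_ghostLift_mvPolynomial hπ.out, map_neg,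
    aeval_genericGhost]
  · rfl
  · intro n
    rw [map_neg, ← neg_sub', dvd_neg]
    exact dvd_genericGhost _ n

theorem ghost_injective_mvPolynomial {ι : Type*} {x y : RamifiedWittVector π (MvPolynomial ι O)}
    (h : ∀ n, ghost x n = ghost y n) : x = y :=
  RamifiedWittVector.ext
    (ghostSeq_injective (mvPolynomial_eq_zero_of_mul hπ.out) (residueCard O) (funext h))

theorem ghost_injective_self {x y : RamifiedWittVector π O}
    (h : ∀ n, ghost x n = ghost y n) : x = y :=
  RamifiedWittVector.ext (ghostSeq_injective
    (fun _ hz => (mul_eq_zero.1 hz).resolve_left hπ.out.ne_zero) (residueCard O) (funext h))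

variable (O) in
/-- Every vector over `B` comes from one over a polynomial ring over `O`. -/
theorem exists_lift (x : RamifiedWittVector π B) :
    ∃ y : RamifiedWittVector π (MvPolynomial B O), mapFun (MvPolynomial.aeval (R := O) id) y = x :=
  mapFun_surjective (fun b => ⟨MvPolynomial.X b, by simp⟩) x

/-- The ring structure on `B^ℕ` for which the ghost components are ring homomorphisms,
functorially in the `O`-algebra `B`. -/
noncomputable instance : CommRing (RamifiedWittVector π B) :=
  CommRing.ofMinimalAxioms
    (fun x y z => by
      obtain ⟨x, rfl⟩ := exists_lift O x
      obtain ⟨y, rfl⟩ := exists_lift O y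
      obtain ⟨z, rfl⟩ := exists_lift O z
      simp only [← mapFun_add]
      congr 1
      refine ghost_injective_mvPolynomial fun n => ?_
      simp only [ghost_add, add_assoc])
    (fun x => by
      obtain ⟨x, rfl⟩ := exists_lift O x
      rw [← mapFun_zero (MvPolynomial.aeval (R := O) id), ← mapFun_add]
      congr 1
      refine ghost_injective_mvPolynomial fun n => ?_
      simp only [ghost_add, ghost_zero, zero_add])
    (fun x => by
      obtain ⟨x, rfl⟩ := exists_lift O x
      rw [← mapFun_zero (MvPolynomial.aeval (R := O) id), ← mapFun_neg, ← mapFun_add]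
      congr 1
      refine ghost_injective_mvPolynomial fun n => ?_
      simp only [ghost_add, ghost_neg, ghost_zero, neg_add_cancel])
    (fun x y z => by
      obtain ⟨x, rfl⟩ := exists_lift O x
      obtain ⟨y, rfl⟩ := exists_lift O y
      obtain ⟨z, rfl⟩ := exists_lift O z
      simp only [← mapFun_mul]
      congr 1
      refine ghost_injective_mvPolynomial fun n => ?_
      simp only [ghost_mul, mul_assoc])
    (fun x y => by
      obtain ⟨x, rfl⟩ := exists_lift O x
      obtain ⟨y, rfl⟩ := exists_lift O y
      simp only [← mapFun_mul]
      congr 1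
      refine ghost_injective_mvPolynomial fun n => ?_
      simp only [ghost_mul, mul_comm])
    (fun x => by
      obtain ⟨x, rfl⟩ := exists_lift O x
      rw [← mapFun_one (MvPolynomial.aeval (R := O) id), ← mapFun_mul]
      congr 1
      refine ghost_injective_mvPolynomial fun n => ?_
      simp only [ghost_mul, ghost_one, one_mul])
    (fun x y z => by
      obtain ⟨x, rfl⟩ := exists_lift O x
      obtain ⟨y, rfl⟩ := exists_lift O y
      obtain ⟨z, rfl⟩ := exists_lift O z
      simp only [← mapFun_add, ← mapFun_mul]
      congr 1
      refine ghost_injective_mvPolynomial fun n => ?_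
      simp only [ghost_mul, ghost_add, mul_add])

/-- The homomorphism induced on ramified Witt vectors by a homomorphism of `O`-algebras. -/
noncomputable def map : RamifiedWittVector π B →+* RamifiedWittVector π C where
  toFun := mapFun f
  map_one' := mapFun_one f
  map_mul' := mapFun_mul f
  map_zero' := mapFun_zero f
  map_add' := mapFun_add f

/-- The ghost map `Φ_B : W_O(B) → B^ℕ`. -/
noncomputable def ghostMap : RamifiedWittVector π B →+* (ℕ → B) where
  toFun := ghost
  map_one' := funext fun n => ghost_one n
  map_mul' x y := funext (ghost_mul x y)
  map_zero' := funext fun n => ghost_zero n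
  map_add' x y := funext (ghost_add x y)

theorem ghost_constSeq (c : O) (n : ℕ) :
    ghost (⟨constSeq π c⟩ : RamifiedWittVector π O) n = c :=
  ghostSeq_ghostLift (dvd_residueCard hπ.out) (RingHom.id O) rfl
    (dvd_sub_pow_residueCard hπ.out) (fun n => by simp) n

variable (π B) in
/-- The structure map `O → W_O(O) → W_O(B)`, where `c` maps to the vector in `W_O(O)` all of whose
ghost components are `c`. -/
noncomputable def ofBase : O →+* RamifiedWittVector π B :=
  (map (Algebra.ofId O B)).comp
    { toFun := fun c => ⟨constSeq π c⟩
      map_one' := ghost_injective_self fun n => by rw [ghost_constSeq, ghost_one]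
      map_mul' := fun a b => ghost_injective_self fun n => by
        rw [ghost_mul, ghost_constSeq, ghost_constSeq, ghost_constSeq]
      map_zero' := ghost_injective_self fun n => by rw [ghost_constSeq, ghost_zero]
      map_add' := fun a b => ghost_injective_self fun n => by
        rw [ghost_add, ghost_constSeq, ghost_constSeq, ghost_constSeq] }

/-- The `O`-algebra structure on `W_O(B)`. -/
noncomputable instance : Algebra O (RamifiedWittVector π B) :=
  (ofBase π B).toAlgebra

/-- The ghost map is `O`-linear for the componentwise action of `O` on `B^ℕ`. -/
theorem ghost_algebraMap (c : O) (n : ℕ) :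
    ghost (algebraMap O (RamifiedWittVector π B) c) n = algebraMap O B c := by
  have h := map_ghostSeq (algebraMap O B) π (residueCard O) (constSeq π c) n
  exact h.symm.trans (congrArg (algebraMap O B) (ghost_constSeq c n))

end Operations

/-! ## The Drinfeld map -/

section Drinfeld

variable (p : ℕ) [Fact p.Prime]

/-- The polynomials `u_0, u_1, …` over `O` determined by `Φ_m(u_0, u_1, …) = w_(mh)(X)`, where `w_n`
is the `n`-th Witt polynomial for `p` and `p ^ h` is the cardinality of the residue field. -/
noncomputable def drinfeldPoly : ℕ → MvPolynomial ℕ O :=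
  structurePoly π fun m => wittPolynomial p O (m * residueDegree O p)

variable {B : Type*} [CommRing B] [Algebra O B]

/-- The function underlying the Drinfeld map. -/
noncomputable def drinfeldFun (b : WittVector p B) : RamifiedWittVector π B :=
  ⟨fun n => MvPolynomial.aeval b.coeff (drinfeldPoly π p n)⟩

theorem drinfeldFun_map {C : Type*} [CommRing C] [Algebra O C] (f : B →ₐ[O] C)
    (b : WittVector p B) :
    drinfeldFun π p (WittVector.map (f : B →+* C) b) = mapFun f (drinfeldFun π p b) := by
  ext n
  change MvPolynomial.aeval _ _ = f (MvPolynomial.aeval _ _)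
  rw [← AlgHom.comp_apply, MvPolynomial.comp_aeval]
  rfl

variable [Finite (ResidueField O)] [hπ : Fact (Irreducible π)] [CharP (ResidueField O) p]

theorem dvd_wittPolynomial (m : ℕ) :
    algebraMap O (MvPolynomial ℕ O) π ^ (m + 1) ∣
      MvPolynomial.expand (residueCard O) (wittPolynomial p O (m * residueDegree O p)) -
        wittPolynomial p O ((m + 1) * residueDegree O p) := by
  have hp : algebraMap O (MvPolynomial ℕ O) π ∣ (p : MvPolynomial ℕ O) := by
    rw [← map_natCast (algebraMap O (MvPolynomial ℕ O))]
    exact map_dvd _ (dvd_prime hπ.out p)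
  have hh := residueDegree_pos O p
  have hle : m ≤ m * residueDegree O p := Nat.le_mul_of_pos_right m hh
  have e0 : ∀ n, wittPolynomial p O n = ∑ i ∈ Finset.range (n + 1),
      (p : MvPolynomial ℕ O) ^ i * MvPolynomial.X i ^ p ^ (n - i) := by
    intro n
    rw [wittPolynomial_eq_sum_C_mul_X_pow]
    simp
  have hq := residueCard_eq O p
  generalize residueDegree O p = h at *
  have e1 : MvPolynomial.expand (residueCard O) (wittPolynomial p O (m * h)) =
      ∑ i ∈ Finset.range (m * h + 1),
        (p : MvPolynomial ℕ O) ^ i * MvPolynomial.X i ^ p ^ ((m + 1) * h - i) := by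
    rw [e0, map_sum]
    refine Finset.sum_congr rfl fun i hi => ?_
    have hi' : i ≤ m * h := Nat.lt_succ_iff.1 (Finset.mem_range.1 hi)
    have e : (m + 1) * h - i = h + (m * h - i) := by rw [add_mul, one_mul]; omega
    rw [map_mul, map_pow, map_natCast, map_pow, MvPolynomial.expand_X, ← pow_mul, e, pow_add p h,
      hq]
  have e2 : m * h + 1 ≤ (m + 1) * h + 1 := by rw [add_mul, one_mul]; omega
  rw [e1, e0, ← Finset.sum_range_add_sum_Ico _ e2, sub_add_cancel_left, dvd_neg]
  refine Finset.dvd_sum fun i hi => Dvd.dvd.mul_right ?_ _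
  have hi' : m * h + 1 ≤ i := (Finset.mem_Ico.1 hi).1
  exact (pow_dvd_pow _ (by omega)).trans (pow_dvd_pow_of_dvd hp i)

theorem ghost_drinfeldFun (b : WittVector p B) (m : ℕ) :
    ghost (drinfeldFun π p b) m = WittVector.ghostComponent (m * residueDegree O p) b := by
  refine (aeval_ghostSeq b.coeff (drinfeldPoly π p) m).symm.trans ?_
  rw [drinfeldPoly, structurePoly, ghostSeq_ghostLift_mvPolynomial hπ.out
    (dvd_wittPolynomial π p), aeval_wittPolynomial, WittVector.ghostComponent_apply,
    aeval_wittPolynomial]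

/-- The Drinfeld map `u_B : W(B) → W_O(B)` for an `O`-algebra `B`, with
`Φ_m(u_B(b)) = w_(mh)(b)`. -/
noncomputable def drinfeld : WittVector p B →+* RamifiedWittVector π B :=
  have lift : ∀ x : WittVector p B, ∃ y : WittVector p (MvPolynomial B O),
      WittVector.map (MvPolynomial.aeval (R := O) (id : B → B) : MvPolynomial B O →+* B) y = x :=
    WittVector.map_surjective _ fun b => ⟨MvPolynomial.X b, by simp⟩
  { toFun := drinfeldFun π p
    map_one' := by
      rw [← map_one (WittVector.map
        (MvPolynomial.aeval (R := O) (id : B → B) : MvPolynomial B O →+* B)), drinfeldFun_map,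
        ← mapFun_one (MvPolynomial.aeval (R := O) (id : B → B))]
      congr 1
      refine ghost_injective_mvPolynomial fun n => ?_
      rw [ghost_drinfeldFun, map_one, ghost_one]
    map_mul' := fun x y => by
      obtain ⟨x, rfl⟩ := lift x
      obtain ⟨y, rfl⟩ := lift y
      rw [← map_mul, drinfeldFun_map, drinfeldFun_map, drinfeldFun_map, ← mapFun_mul]
      congr 1
      refine ghost_injective_mvPolynomial fun n => ?_
      rw [ghost_mul, ghost_drinfeldFun, ghost_drinfeldFun, ghost_drinfeldFun, map_mul]
    map_zero' := by
      rw [← map_zero (WittVector.map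
        (MvPolynomial.aeval (R := O) (id : B → B) : MvPolynomial B O →+* B)), drinfeldFun_map,
        ← mapFun_zero (MvPolynomial.aeval (R := O) (id : B → B))]
      congr 1
      refine ghost_injective_mvPolynomial fun n => ?_
      rw [ghost_drinfeldFun, map_zero, ghost_zero]
    map_add' := fun x y => by
      obtain ⟨x, rfl⟩ := lift x
      obtain ⟨y, rfl⟩ := lift y
      rw [← map_add, drinfeldFun_map, drinfeldFun_map, drinfeldFun_map, ← mapFun_add]
      congr 1
      refine ghost_injective_mvPolynomial fun n => ?_
      rw [ghost_add, ghost_drinfeldFun, ghost_drinfeldFun, ghost_drinfeldFun, map_add] }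

end Drinfeld

end RamifiedWittVector

/-! ## The canonical homomorphism `W(k) → O` -/

section Canonical

variable (p : ℕ) [Fact p.Prime] (O : Type*) [CommRing O] [IsDomain O] [IsDiscreteValuationRing O]
  [Finite (ResidueField O)] [CharP (ResidueField O) p]

variable {O} in
theorem dvd_ghostComponent_sub {π : O} (hπ : Irreducible π) (x : WittVector p O) (m j : ℕ) :
    π ^ (m + 1) ∣ WittVector.ghostComponent ((m + j) * residueDegree O p) x -
      WittVector.ghostComponent (m * residueDegree O p) x := by
  have : Fact (Irreducible π) := ⟨hπ⟩
  have step : ∀ m, π ^ (m + 1) ∣ WittVector.ghostComponent ((m + 1) * residueDegree O p) x -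
      WittVector.ghostComponent (m * residueDegree O p) x := by
    intro m
    rw [← RamifiedWittVector.ghost_drinfeldFun π p x,
      ← RamifiedWittVector.ghost_drinfeldFun π p x, RamifiedWittVector.ghost,
      RamifiedWittVector.ghost, ghostSeq_eq_add, Algebra.algebraMap_self, RingHom.id_apply,
      add_sub_right_comm, ghostSeq, ← Finset.sum_sub_distrib]
    refine dvd_add (Finset.dvd_sum fun i hi => ?_) (dvd_mul_right _ _)
    have hi' : i ≤ m := Nat.lt_succ_iff.1 (Finset.mem_range.1 hi)
    have e1 : m + 1 - i = 1 + (m - i) := by omega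
    have e2 : m + 1 = i + (m - i + 1) := by omega
    rw [← mul_sub, e1, pow_add (residueCard O), pow_one, pow_mul, e2, pow_add π i]
    refine mul_dvd_mul_left _ (dvd_pow_sub_pow (dvd_residueCard hπ) ?_ _)
    rw [← dvd_neg, neg_sub]
    exact dvd_sub_pow_residueCard hπ _
  induction j with
  | zero => simp
  | succ j ih =>
    have := dvd_add ((pow_dvd_pow π (by omega)).trans (step (m + j))) ih
    rwa [sub_add_sub_cancel] at this

variable {O} in
theorem dvd_ghostComponent {π : O} (hπ : Irreducible π) (x : WittVector p O)
    (hx : ∀ i, π ∣ x.coeff i) (n : ℕ) : π ^ (n + 1) ∣ WittVector.ghostComponent n x := by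
  rw [WittVector.ghostComponent_apply, aeval_wittPolynomial]
  refine Finset.dvd_sum fun i hi => ?_
  have hi' : i ≤ n := Nat.lt_succ_iff.1 (Finset.mem_range.1 hi)
  have h1 := dvd_pow_sub_pow (dvd_prime hπ p) (a := x.coeff i) (b := 0)
    (by simpa using hx i) (n - i)
  rw [zero_pow (pow_ne_zero _ (Fact.out : p.Prime).ne_zero), sub_zero] at h1
  rw [show n + 1 = i + (n - i + 1) by omega, pow_add]
  exact mul_dvd_mul (pow_dvd_pow_of_dvd (dvd_prime hπ p) i) h1

variable {O} in
theorem mk_maximalIdeal_pow_eq_iff {π : O} (hπ : Irreducible π) (n : ℕ) (x y : O) :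
    Ideal.Quotient.mk (maximalIdeal O ^ n) x = Ideal.Quotient.mk (maximalIdeal O ^ n) y ↔
      π ^ n ∣ x - y := by
  rw [Ideal.Quotient.mk_eq_mk_iff_sub_mem, hπ.maximalIdeal_eq, Ideal.span_singleton_pow,
    Ideal.mem_span_singleton]

/-- The homomorphism `W(k) → O / 𝔪^n` mapping the reduction of `x ∈ W(O)` to `w_(nh)(x)`. -/
noncomputable def wittToBaseMod (n : ℕ) :
    WittVector p (ResidueField O) →+* O ⧸ maximalIdeal O ^ n :=
  RingHom.liftOfSurjective (WittVector.map (residue O))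
    (WittVector.map_surjective _ residue_surjective)
    ⟨(Ideal.Quotient.mk (maximalIdeal O ^ n)).comp
      (WittVector.ghostComponent (n * residueDegree O p)), fun x hx => by
        obtain ⟨π, hπ⟩ := IsDiscreteValuationRing.exists_irreducible O
        rw [RingHom.mem_ker, WittVector.map_eq_zero_iff] at hx
        rw [RingHom.mem_ker, RingHom.comp_apply, ← map_zero (Ideal.Quotient.mk _),
          mk_maximalIdeal_pow_eq_iff hπ, sub_zero]
        have hle := Nat.le_mul_of_pos_right n (residueDegree_pos O p)
        exact (pow_dvd_pow π (by omega)).trans (dvd_ghostComponent p hπ x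
          (fun i => (dvd_iff_residue_eq_zero hπ _).2 (hx i)) _)⟩

theorem wittToBaseMod_map (n : ℕ) (x : WittVector p O) :
    wittToBaseMod p O n (WittVector.map (residue O) x) =
      Ideal.Quotient.mk _ (WittVector.ghostComponent (n * residueDegree O p) x) :=
  RingHom.liftOfSurjective_comp_apply ..

theorem wittToBaseMod_compat {m n : ℕ} (hle : m ≤ n) :
    (Ideal.Quotient.factorPow (maximalIdeal O) hle).comp (wittToBaseMod p O n) =
      wittToBaseMod p O m := by
  obtain ⟨π, hπ⟩ := IsDiscreteValuationRing.exists_irreducible O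
  ext x
  obtain ⟨x, rfl⟩ := WittVector.map_surjective (residue O) residue_surjective x
  rw [RingHom.comp_apply, wittToBaseMod_map, wittToBaseMod_map]
  refine (mk_maximalIdeal_pow_eq_iff hπ m _ _).2 ?_
  obtain ⟨j, rfl⟩ := Nat.exists_eq_add_of_le hle
  exact (pow_dvd_pow π (by omega)).trans (dvd_ghostComponent_sub p hπ x m j)

variable [IsAdicComplete (maximalIdeal O) O]

/-- The canonical homomorphism `W(k) → O`, i.e. the unique one that induces the identity on residue
fields (`residue_wittToBase`, `wittToBase_unique`). -/
noncomputable def wittToBase : WittVector p (ResidueField O) →+* O :=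
  IsAdicComplete.liftRingHom (maximalIdeal O) (wittToBaseMod p O)
    (wittToBaseMod_compat p O)

variable {O} in
theorem dvd_wittToBase_sub {π : O} (hπ : Irreducible π) (x : WittVector p O) (m : ℕ) :
    π ^ (m + 1) ∣ wittToBase p O (WittVector.map (residue O) x) -
      WittVector.ghostComponent (m * residueDegree O p) x := by
  have h1 : Ideal.Quotient.mk (maximalIdeal O ^ (m + 1))
      (wittToBase p O (WittVector.map (residue O) x)) = Ideal.Quotient.mk _
        (WittVector.ghostComponent ((m + 1) * residueDegree O p) x) := by
    rw [← wittToBaseMod_map]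
    exact IsAdicComplete.mk_liftRingHom _ _ (wittToBaseMod_compat p O) _ _
  have := dvd_add ((mk_maximalIdeal_pow_eq_iff hπ _ _ _).1 h1)
    (dvd_ghostComponent_sub p hπ x m 1)
  rwa [sub_add_sub_cancel] at this

theorem residue_wittToBase (x : WittVector p (ResidueField O)) :
    residue O (wittToBase p O x) = x.coeff 0 := by
  obtain ⟨π, hπ⟩ := IsDiscreteValuationRing.exists_irreducible O
  obtain ⟨x, rfl⟩ := WittVector.map_surjective (residue O) residue_surjective x
  have h := dvd_wittToBase_sub p hπ x 0
  rw [zero_add, pow_one, dvd_iff_residue_eq_zero hπ, map_sub, sub_eq_zero] at h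
  rw [h, WittVector.ghostComponent_apply, aeval_wittPolynomial]
  simp

theorem wittToBase_unique (φ : WittVector p (ResidueField O) →+* O)
    (hφ : ∀ x, residue O (φ x) = x.coeff 0) : φ = wittToBase p O := by
  obtain ⟨π, hπ⟩ := IsDiscreteValuationRing.exists_irreducible O
  refine IsAdicComplete.eq_liftRingHom (maximalIdeal O) _ (wittToBaseMod_compat p O) φ fun n => ?_
  have key : (Ideal.Quotient.mk (maximalIdeal O ^ n)).comp φ =
      (Ideal.Quotient.mk (maximalIdeal O ^ n)).comp (wittToBase p O) := by
    refine WittVector.eq_of_apply_teichmuller_eq _ _ ⟨n, ?_⟩ fun a => ?_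
    · rw [← map_natCast (Ideal.Quotient.mk (maximalIdeal O ^ n)), ← map_pow,
        ← map_zero (Ideal.Quotient.mk _), mk_maximalIdeal_pow_eq_iff hπ, sub_zero]
      exact pow_dvd_pow_of_dvd (dvd_prime hπ p) n
    · have : Fintype (ResidueField O) := Fintype.ofFinite _
      have ha : a ^ residueCard O ^ n = a := by
        rw [residueCard, Nat.card_eq_fintype_card, FiniteField.pow_card_pow]
      have ht : WittVector.teichmuller p a ^ residueCard O ^ n = WittVector.teichmuller p a := by
        rw [← map_pow, ha]
      rw [RingHom.comp_apply, RingHom.comp_apply, mk_maximalIdeal_pow_eq_iff hπ, ← ht, map_pow,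
        map_pow]
      refine (pow_dvd_pow π (Nat.le_succ n)).trans (dvd_pow_sub_pow (dvd_residueCard hπ) ?_ n)
      rw [dvd_iff_residue_eq_zero hπ, map_sub, hφ, residue_wittToBase, sub_self]
  rw [key]
  exact IsAdicComplete.mk_comp_liftRingHom _ _ (wittToBaseMod_compat p O) _

end Canonical

/-! ## The map `r_A : W(A) ⊗_{W(k)} O → W_O(A)` -/

/-- For an `R`-algebra `S`, the ring `W(S)` is a `W(R)`-algebra by functoriality. -/
noncomputable instance wittVectorAlgebra (p : ℕ) [Fact p.Prime] (R S : Type*) [CommRing R]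
    [CommRing S] [Algebra R S] : Algebra (WittVector p R) (WittVector p S) :=
  (WittVector.map (algebraMap R S)).toAlgebra

section Comparison

open scoped TensorProduct

variable (p : ℕ) [Fact p.Prime] {O : Type*} [CommRing O] [IsDomain O] [IsDiscreteValuationRing O]
  [Finite (ResidueField O)] [CharP (ResidueField O) p] [IsAdicComplete (maximalIdeal O) O]
  (π : O) [hπ : Fact (Irreducible π)]

/-- `O` as an algebra over the Witt vectors of its residue field. -/
noncomputable instance baseAlgebra : Algebra (WittVector p (ResidueField O)) O :=
  (wittToBase p O).toAlgebra

/-- `W_O(B)` as an algebra over `W(k)`, by restriction of scalars from `O`. -/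
noncomputable instance ramifiedAlgebra (B : Type*) [CommRing B] [Algebra O B] :
    Algebra (WittVector p (ResidueField O)) (RamifiedWittVector π B) :=
  ((algebraMap O (RamifiedWittVector π B)).comp (wittToBase p O)).toAlgebra

instance ramifiedTower (B : Type*) [CommRing B] [Algebra O B] :
    IsScalarTower (WittVector p (ResidueField O)) O (RamifiedWittVector π B) :=
  IsScalarTower.of_algebraMap_eq fun _ => rfl

variable (A : Type*) [CommRing A] [Algebra O A] [Algebra (ResidueField O) A]
  [IsScalarTower O (ResidueField O) A]

theorem drinfeld_algebraMap (x : WittVector p (ResidueField O)) :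
    RamifiedWittVector.drinfeld π p (algebraMap _ (WittVector p A) x) =
      algebraMap _ (RamifiedWittVector π A) x := by
  obtain ⟨x, rfl⟩ := WittVector.map_surjective (residue O) residue_surjective x
  have h1 : algebraMap (WittVector p (ResidueField O)) (WittVector p A)
      (WittVector.map (residue O) x) =
        WittVector.map (Algebra.ofId O A : O →+* A) x := by
    ext n
    exact (IsScalarTower.algebraMap_apply O (ResidueField O) A (x.coeff n)).symm
  rw [h1]
  refine (RamifiedWittVector.drinfeldFun_map π p (Algebra.ofId O A) x).trans ?_
  ext n
  change algebraMap O A ((RamifiedWittVector.drinfeldFun π p x).coeff n) =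
    algebraMap O A (RamifiedWittVector.constSeq π (wittToBase p O _) n)
  rw [IsScalarTower.algebraMap_apply O (ResidueField O) A,
    IsScalarTower.algebraMap_apply O (ResidueField O) A]
  congr 1
  refine sub_eq_zero.1 ((map_sub (residue O) _ _).symm.trans
    ((dvd_iff_residue_eq_zero hπ.out _).1 ?_))
  refine dvd_sub_of_ghostSeq hπ.out.ne_zero (dvd_residueCard hπ.out) (fun m => ?_) n
  have e1 := RamifiedWittVector.ghost_drinfeldFun π p x m
  have e2 := RamifiedWittVector.ghost_constSeq (π := π)
    (wittToBase p O (WittVector.map (residue O) x)) m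
  rw [RamifiedWittVector.ghost, Algebra.algebraMap_self, RingHom.id_apply] at e1 e2
  rw [e1, e2, ← dvd_neg, neg_sub]
  exact dvd_wittToBase_sub p hπ.out x m

/-- The Drinfeld map of a `k`-algebra `A` as a homomorphism of `W(k)`-algebras. -/
noncomputable def drinfeldAlgHom :
    WittVector p A →ₐ[WittVector p (ResidueField O)] RamifiedWittVector π A :=
  { RamifiedWittVector.drinfeld π p with commutes' := drinfeld_algebraMap p π A }

/-- The homomorphism `r_A : W(A) ⊗_{W(k)} O → W_O(A)`, `x ⊗ c ↦ c • u_A(x)`, extending the Drinfeld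
map of a `k`-algebra `A`. -/
noncomputable def greenbergToRamified :
    WittVector p A ⊗[WittVector p (ResidueField O)] O →ₐ[WittVector p (ResidueField O)]
      RamifiedWittVector π A :=
  Algebra.TensorProduct.productMap (drinfeldAlgHom p π A)
    (IsScalarTower.toAlgHom (WittVector p (ResidueField O)) O (RamifiedWittVector π A))

theorem greenbergToRamified_tmul (x : WittVector p A) (c : O) :
    greenbergToRamified p π A (x ⊗ₜ c) = c • RamifiedWittVector.drinfeld π p x := by
  rw [Algebra.smul_def, mul_comm]
  rfl

end Comparison

/-- A ring of characteristic `p` is semiperfect if its Frobenius is surjective. -/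
def IsSemiperfect (p : ℕ) (A : Type*) [CommRing A] : Prop :=
  Function.Surjective fun a : A => a ^ p

/-- A ring of characteristic `p` is perfect if its Frobenius is bijective. -/
def IsPerfect (p : ℕ) (A : Type*) [CommRing A] : Prop :=
  Function.Bijective fun a : A => a ^ p

/-!
Let `k` be the residue field of `O`. Since `O` is finite and free over `W(k)`, the ring
`W(A) ⊗_{W(k)} O` is finite and free over `W(A)`, so for semiperfect `A` it inherits `p`-adic, hence
`π`-adic, completeness from `W(A)`. On `W_O(A)`, multiplication by `π` is
`(b_0, b_1, …) ↦ (0, b_0^q, b_1^q, …)`, so `W_O(A)` is `π`-adically separated, with reduction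
`b ↦ b_0` modulo `π` when `A` is semiperfect. As `r_A` induces the identity of `A` modulo `π`, it is
surjective by successive approximation. If `A` is also reduced, then `π` is regular on `W_O(A)`, and
injectivity modulo `π` gives injectivity. A merely reduced `A` embeds into its perfect closure, and
this embedding stays injective after `W(-) ⊗_{W(k)} O` because `O` is flat over `W(k)`. Finally,
`O → W_O(k)` is the map `r_k`.
-/

/-! ## Adic topologies on modules -/

section Adic

variable {R M : Type*} [CommRing R] [AddCommGroup M] [Module R M]

theorem isHausdorff_of_pow_le {I J : Ideal R} {e : ℕ} (h : I ^ e ≤ J) [IsHausdorff J M] :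
    IsHausdorff I M where
  haus' x hx := by
    refine IsHausdorff.haus (I := J) inferInstance x fun n => ?_
    refine (hx (e * n)).mono (Submodule.smul_mono_left ?_)
    rw [pow_mul]
    exact Ideal.pow_right_mono h n

theorem isPrecomplete_of_pow_le {I J : Ideal R} {e : ℕ} (hJI : J ≤ I) (hIJ : I ^ e ≤ J)
    [IsPrecomplete J M] : IsPrecomplete I M where
  prec' f hf := by
    have hle (n : ℕ) : I ^ (n * (e + 1)) ≤ J ^ n := by
      rw [mul_comm, pow_mul]
      exact Ideal.pow_right_mono ((Ideal.pow_le_pow_right e.le_succ).trans hIJ) n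
    obtain ⟨L, hL⟩ := IsPrecomplete.prec (I := J) (M := M) inferInstance
      (f := fun n => f (n * (e + 1))) fun {m n} hmn =>
        (hf (Nat.mul_le_mul_right _ hmn)).mono (Submodule.smul_mono_left (hle m))
    refine ⟨L, fun n => (hf (Nat.le_mul_of_pos_right n e.succ_pos)).trans ?_⟩
    exact (hL n).mono (Submodule.smul_mono_left (Ideal.pow_right_mono hJI n))

theorem isHausdorff_of_free (I : Ideal R) [IsHausdorff I R] [Module.Free R M] :
    IsHausdorff I M where
  haus' x hx := by
    let b := Module.Free.chooseBasis R M
    refine b.ext_elem fun i => ?_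
    rw [map_zero, Finsupp.zero_apply]
    refine IsHausdorff.haus (I := I) inferInstance _ fun n => SModEq.zero.2 ?_
    exact Submodule.smul_top_le_comap_smul_top _ (b.coord i) (SModEq.zero.1 (hx n))

theorem isPrecomplete_of_finite (I : Ideal R) [IsPrecomplete I R] [Module.Finite R M] :
    IsPrecomplete I M := by
  refine AdicCompletion.of_surjective_iff.1 fun y => ?_
  obtain ⟨t, rfl⟩ := AdicCompletion.ofTensorProduct_surjective_of_finite I M y
  induction t with
  | zero => exact ⟨0, by rw [map_zero, map_zero]⟩
  | tmul r x =>
    obtain ⟨r, rfl⟩ := AdicCompletion.of_surjective I R r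
    refine ⟨r • x, ?_⟩
    rw [AdicCompletion.ofTensorProduct_tmul, map_smul]
    rfl
  | add s t hs ht =>
    obtain ⟨x, hx⟩ := hs
    obtain ⟨y, hy⟩ := ht
    exact ⟨x + y, by rw [map_add, map_add, hx, hy]⟩

theorem finite_of_finite_quotient (I : Ideal R) [IsPrecomplete I R] [IsHausdorff I M]
    [Module.Finite R (M ⧸ (I • ⊤ : Submodule R M))] : Module.Finite R M := by
  obtain ⟨n, f, hf⟩ := Module.Finite.exists_fin' R (M ⧸ (I • ⊤ : Submodule R M))
  obtain ⟨g, hg⟩ := Module.projective_lifting_property (I • ⊤ : Submodule R M).mkQ f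
    (Submodule.mkQ_surjective _)
  have := isPrecomplete_of_finite (M := Fin n → R) I
  exact .of_surjective g (surjective_of_mkQ_comp_surjective (I := I) (hg ▸ hf))

theorem injective_of_dvd_of_map_dvd {S : Type*} [CommRing S] (f : R →+* S) {a : R}
    [IsHausdorff (Ideal.span {a}) R] (ha : IsLeftRegular (f a)) (h : ∀ x, f a ∣ f x → a ∣ x) :
    Function.Injective f := by
  refine (injective_iff_map_eq_zero _).2 fun x hx => ?_
  refine IsHausdorff.haus (I := Ideal.span {a}) inferInstance x fun n => ?_
  rw [SModEq.zero, smul_eq_mul, Ideal.mul_top, Ideal.span_singleton_pow,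
    Ideal.mem_span_singleton]
  induction n generalizing x with
  | zero => exact pow_zero a ▸ one_dvd x
  | succ n ih =>
    obtain ⟨y, rfl⟩ := h x (hx ▸ dvd_zero _)
    rw [map_mul] at hx
    rw [pow_succ']
    exact mul_dvd_mul_left a (ih y (ha (hx.trans (mul_zero _).symm)))

end Adic

/-! ## Witt vectors over rings of characteristic `p` -/

section Semiperfect

variable {p : ℕ} {A : Type*} [CommRing A]

theorem IsSemiperfect.pow_surjective (hA : IsSemiperfect p A) (n : ℕ) :
    Function.Surjective fun a : A => a ^ p ^ n := by
  have h := Function.Surjective.iterate hA n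
  rwa [pow_iterate] at h

variable [Fact p.Prime]

theorem IsPerfect.isReduced (hA : IsPerfect p A) : IsReduced A := by
  have hp : p.Prime := Fact.out
  refine (isReduced_iff_pow_one_lt p hp.one_lt).2 fun x hx => hA.1 ?_
  exact hx.trans (zero_pow hp.ne_zero).symm

variable [CharP A p]

theorem perfectClosure_of_injective [IsReduced A] :
    Function.Injective (PerfectClosure.of A p) := fun x y h => by
  simpa using (PerfectClosure.eq_iff A p (0, x) (0, y)).1 h

theorem isHausdorff_wittVector :
    IsHausdorff (Ideal.span {(p : WittVector p A)}) (WittVector p A) where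
  haus' x hx := by
    ext n
    have h := SModEq.zero.1 (hx (n + 1))
    rw [smul_eq_mul, Ideal.mul_top, Ideal.span_singleton_pow, Ideal.mem_span_singleton'] at h
    obtain ⟨y, rfl⟩ := h
    rw [WittVector.mul_pow_charP_coeff_zero _ n.lt_succ_self, WittVector.zero_coeff]

theorem IsSemiperfect.natCast_pow_dvd_iff (hA : IsSemiperfect p A) (x : WittVector p A) (n : ℕ) :
    (p : WittVector p A) ^ n ∣ x ↔ ∀ i < n, x.coeff i = 0 := by
  constructor
  · rintro ⟨y, rfl⟩ i hi
    rw [mul_comm, WittVector.mul_pow_charP_coeff_zero _ hi]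
  · intro h
    have hF : Function.Surjective (WittVector.frobenius : WittVector p A →+* WittVector p A) := by
      rw [WittVector.frobenius_eq_map_frobenius]
      exact WittVector.map_surjective _ hA
    obtain ⟨y, hy⟩ := hF.iterate n (x.shift n)
    refine ⟨y, ?_⟩
    rw [mul_comm, ← WittVector.iterate_verschiebung_iterate_frobenius, hy]
    exact WittVector.eq_iterate_verschiebung h

theorem IsSemiperfect.isPrecomplete_wittVector (hA : IsSemiperfect p A) :
    IsPrecomplete (Ideal.span {(p : WittVector p A)}) (WittVector p A) where
  prec' x h := by
    refine ⟨.mk p fun n => (x (n + 1)).coeff n, fun n => ?_⟩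
    simp only [Ideal.span_singleton_pow, smul_eq_mul, Ideal.mul_top, SModEq.sub_mem,
      Ideal.mem_span_singleton, hA.natCast_pow_dvd_iff,
      ← WittVector.le_coeff_eq_iff_le_sub_coeff_eq_zero] at h ⊢
    exact fun i hi => (h hi i i.lt_succ_self).symm

end Semiperfect

/-! ## The base ring as a module over `W(k)` -/

section Base

theorem natCast_mem_maximalIdeal (p : ℕ) (O : Type*) [CommRing O] [IsLocalRing O]
    [CharP (ResidueField O) p] : (p : O) ∈ maximalIdeal O := by
  rw [← residue_eq_zero_iff, map_natCast, CharP.cast_eq_zero]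

theorem exists_maximalIdeal_pow_eq_span_natCast (O : Type*) [CommRing O] [IsDomain O]
    [IsDiscreteValuationRing O] [CharZero O] {n : ℕ} (hn : n ≠ 0) :
    ∃ e : ℕ, maximalIdeal O ^ e = Ideal.span {(n : O)} := by
  have hbot : Ideal.span {(n : O)} ≠ ⊥ := by
    rwa [Ne, Ideal.span_singleton_eq_bot, Nat.cast_eq_zero]
  obtain ⟨e, he⟩ := exists_maximalIdeal_pow_eq_of_principal O inferInstance _ hbot
  exact ⟨e, he.symm⟩

variable (p : ℕ) [hp : Fact p.Prime] (O : Type*) [CommRing O] [IsDomain O]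
  [IsDiscreteValuationRing O] [CharP (ResidueField O) p] [IsAdicComplete (maximalIdeal O) O]
  [Finite (ResidueField O)]

theorem isHausdorff_span_natCast :
    IsHausdorff (Ideal.span {(p : WittVector p (ResidueField O))}) O := by
  refine IsHausdorff.of_map (J := maximalIdeal O) ?_
  rw [Ideal.map_span, Set.image_singleton, map_natCast, Ideal.span_singleton_le_iff_mem]
  exact natCast_mem_maximalIdeal p O

variable [CharZero O]

theorem wittToBase_injective : Function.Injective (wittToBase p O) := by
  refine (injective_iff_map_eq_zero _).2 fun x hx => ?_
  by_contra hx0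
  obtain ⟨n, u, rfl⟩ := WittVector.exists_eq_pow_p_mul' x hx0
  rw [map_mul, map_pow, map_natCast, (u.isUnit.map _).mul_left_eq_zero] at hx
  exact pow_ne_zero n (Nat.cast_ne_zero.2 hp.out.ne_zero) hx

instance finite_wittVector_residueField : Module.Finite (WittVector p (ResidueField O)) O := by
  let I := Ideal.span {(p : WittVector p (ResidueField O))}
  have : IsHausdorff I O := isHausdorff_span_natCast p O
  have : Module.Finite (WittVector p (ResidueField O))
      (O ⧸ (I • ⊤ : Submodule (WittVector p (ResidueField O)) O)) := by
    rw [Ideal.smul_top_eq_map, Ideal.map_span, Set.image_singleton, map_natCast]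
    obtain ⟨e, he⟩ := exists_maximalIdeal_pow_eq_span_natCast O hp.out.ne_zero
    have : Finite (O ⧸ Ideal.span {(p : O)}) := finite_quotient_iff.2 ⟨e, he.le⟩
    have := Finite.of_equiv _ (Submodule.Quotient.restrictScalarsEquiv
      (WittVector p (ResidueField O)) (Ideal.span {(p : O)})).symm.toEquiv
    infer_instance
  exact finite_of_finite_quotient I

instance free_wittVector_residueField : Module.Free (WittVector p (ResidueField O)) O := by
  have : FaithfulSMul (WittVector p (ResidueField O)) O :=
    (faithfulSMul_iff_algebraMap_injective _ _).2 (wittToBase_injective p O)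
  have : Module.IsTorsionFree (WittVector p (ResidueField O)) O := .trans_faithfulSMul _ O O
  exact Module.free_of_finite_type_torsion_free'

end Base

/-! ## Multiplication by the uniformizer on ramified Witt vectors -/

namespace RamifiedWittVector

variable {O : Type*} [CommRing O] [IsDomain O] [IsDiscreteValuationRing O]
  [Finite (ResidueField O)] {π : O}

/-- The vector `(0, b_0^q, b_1^q, …)`, which is the product `π · b` when `π = 0` in the coefficient
ring: the analogue of the composite `V F` of Verschiebung and Frobenius. -/
noncomputable def shiftPow {B : Type*} [CommRing B] (x : RamifiedWittVector π B) :
    RamifiedWittVector π B :=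
  ⟨fun n => n.casesOn 0 fun m => x.coeff m ^ residueCard O⟩

theorem ghost_shiftPow_add {B : Type*} [CommRing B] [Algebra O B] (x : RamifiedWittVector π B)
    (n : ℕ) : ghost (shiftPow x) n + algebraMap O B π ^ (n + 1) * x.coeff n =
      algebraMap O B π * ghost x n := by
  have h0 : (shiftPow x).coeff 0 = 0 := rfl
  have hsucc (i : ℕ) : (shiftPow x).coeff (i + 1) = x.coeff i ^ residueCard O := rfl
  rw [ghost, ghost, ghostSeq_eq_add _ _ x.coeff, ghostSeq, Finset.sum_range_succ', mul_add,
    Finset.mul_sum, ← mul_assoc, ← pow_succ', h0,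
    zero_pow (pow_ne_zero _ (residueCard_pos O).ne'), mul_zero, add_zero]
  congr 1
  refine Finset.sum_congr rfl fun i hi => ?_
  have hexp : n - (i + 1) + 1 = n - i := by
    have := Finset.mem_range.1 hi
    omega
  rw [hsucc, ← pow_mul, ← pow_succ', pow_succ', mul_assoc, hexp]

variable [hπ : Fact (Irreducible π)]

section Algebra

variable {B C : Type*} [CommRing B] [Algebra O B] [CommRing C] [Algebra O C]

theorem map_algebraMap (f : B →ₐ[O] C) (c : O) :
    map f (algebraMap O (RamifiedWittVector π B) c) = algebraMap O (RamifiedWittVector π C) c := by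
  ext n
  exact f.commutes (constSeq π c n)

theorem map_smul (f : B →ₐ[O] C) (c : O) (x : RamifiedWittVector π B) :
    map f (c • x) = c • map f x := by
  rw [Algebra.smul_def, Algebra.smul_def, map_mul, map_algebraMap]

theorem map_shiftPow (f : B →ₐ[O] C) (x : RamifiedWittVector π B) :
    map f (shiftPow x) = shiftPow (map f x) := by
  ext n
  cases n with
  | zero => exact map_zero f
  | succ n => exact map_pow f _ _

/-- The projection `W_O(B) → B`, `b ↦ b_0`, as a ring homomorphism: it is the ghost map `Φ_0`. -/
noncomputable def coeffZero : RamifiedWittVector π B →+* B :=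
  (Pi.evalRingHom (fun _ => B) 0).comp ghostMap

theorem coeffZero_apply (x : RamifiedWittVector π B) : coeffZero x = x.coeff 0 := by
  change ghostSeq _ _ _ 0 = _
  simp [ghostSeq]

theorem coeffZero_algebraMap (c : O) :
    coeffZero (algebraMap O (RamifiedWittVector π B) c) = algebraMap O B c :=
  ghost_algebraMap c 0

theorem coeffZero_drinfeld (p : ℕ) [Fact p.Prime] [CharP (ResidueField O) p]
    (x : WittVector p B) : coeffZero (drinfeld π p x) = x.coeff 0 := by
  refine (ghost_drinfeldFun π p x 0).trans ?_
  simp [WittVector.ghostComponent_apply]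

end Algebra

theorem algebraMap_dvd_coeff_sub_shiftPow {P : Type*} [CommRing P] [IsDomain P] [Algebra O P]
    (hP : algebraMap O P π ≠ 0) (x : RamifiedWittVector π P) (n : ℕ) :
    algebraMap O P π ∣
      (algebraMap O (RamifiedWittVector π P) π * x).coeff n - (shiftPow x).coeff n := by
  refine dvd_sub_of_ghostSeq (q := residueCard O) hP ?_ (fun m => ?_) n
  · rw [← map_natCast (algebraMap O P)]
    exact map_dvd _ (dvd_residueCard hπ.out)
  · change _ ∣ ghost _ m - ghost _ m
    rw [ghost_mul, ghost_algebraMap, ← ghost_shiftPow_add, add_sub_cancel_left]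
    exact dvd_mul_right _ _

section Residue

variable {A : Type*} [CommRing A] [Algebra O A]

theorem algebraMap_mul_eq_shiftPow (hA : algebraMap O A π = 0) (x : RamifiedWittVector π A) :
    algebraMap O _ π * x = shiftPow x := by
  obtain ⟨x, rfl⟩ := exists_lift O x
  have hP : algebraMap O (MvPolynomial A O) π ≠ 0 :=
    (map_ne_zero_iff _ (MvPolynomial.C_injective A O)).2 hπ.out.ne_zero
  change algebraMap O _ π * map (MvPolynomial.aeval (R := O) id) x = shiftPow (map _ x)
  rw [← map_algebraMap (MvPolynomial.aeval (R := O) (id : A → A)), ← map_mul, ← map_shiftPow]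
  ext n
  have h := map_dvd (MvPolynomial.aeval (R := O) (id : A → A))
    (algebraMap_dvd_coeff_sub_shiftPow hP x n)
  rwa [AlgHom.commutes, hA, zero_dvd_iff, map_sub, sub_eq_zero] at h

theorem coeff_algebraMap_pow_mul (hA : algebraMap O A π = 0) (x : RamifiedWittVector π A)
    {n i : ℕ} (hi : i < n) : (algebraMap O _ π ^ n * x).coeff i = 0 := by
  induction n generalizing i with
  | zero => omega
  | succ n ih =>
    rw [pow_succ', mul_assoc, algebraMap_mul_eq_shiftPow hA]
    cases i with
    | zero => rfl
    | succ i =>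
      change _ ^ residueCard O = 0
      rw [ih (by omega), zero_pow (residueCard_pos O).ne']

theorem isHausdorff_span_algebraMap (hA : algebraMap O A π = 0) :
    IsHausdorff (Ideal.span {algebraMap O (RamifiedWittVector π A) π})
      (RamifiedWittVector π A) where
  haus' x hx := by
    ext n
    have h := SModEq.zero.1 (hx (n + 1))
    rw [smul_eq_mul, Ideal.mul_top, Ideal.span_singleton_pow, Ideal.mem_span_singleton] at h
    obtain ⟨y, rfl⟩ := h
    exact coeff_algebraMap_pow_mul hA y n.lt_succ_self

theorem isLeftRegular_algebraMap [IsReduced A] (hA : algebraMap O A π = 0) :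
    IsLeftRegular (algebraMap O (RamifiedWittVector π A) π) := by
  refine isLeftRegular_iff_right_eq_zero_of_mul.2 fun x hx => ?_
  rw [algebraMap_mul_eq_shiftPow hA] at hx
  ext n
  have hn : x.coeff n ^ residueCard O = 0 := congrArg (fun z => z.coeff (n + 1)) hx
  exact eq_zero_of_pow_eq_zero hn

theorem algebraMap_dvd_iff (hA : algebraMap O A π = 0)
    (hq : Function.Surjective fun a : A => a ^ residueCard O) (x : RamifiedWittVector π A) :
    algebraMap O _ π ∣ x ↔ coeffZero x = 0 := by
  constructor
  · rintro ⟨y, rfl⟩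
    rw [map_mul, coeffZero_algebraMap, hA, zero_mul]
  · intro h
    rw [coeffZero_apply] at h
    choose root hroot using hq
    refine ⟨⟨fun n => root (x.coeff (n + 1))⟩, ?_⟩
    rw [algebraMap_mul_eq_shiftPow hA]
    ext n
    cases n with
    | zero => exact h
    | succ n => exact (hroot _).symm

end Residue

end RamifiedWittVector

/-! ## The comparison map -/

section Comparison

open scoped TensorProduct

theorem IsSemiperfect.pow_residueCard_surjective {p : ℕ} [Fact p.Prime] {O : Type*} [CommRing O]
    [IsLocalRing O] [Finite (ResidueField O)] [CharP (ResidueField O) p] {A : Type*} [CommRing A]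
    (hA : IsSemiperfect p A) : Function.Surjective fun a : A => a ^ residueCard O := by
  rw [residueCard_eq O p]
  exact hA.pow_surjective _

theorem algebraMap_uniformizer_eq_zero {O : Type*} [CommRing O] [IsDomain O]
    [IsDiscreteValuationRing O] {π : O} (hπ : Irreducible π) (A : Type*) [CommRing A]
    [Algebra O A] [Algebra (ResidueField O) A] [IsScalarTower O (ResidueField O) A] :
    algebraMap O A π = 0 := by
  rw [IsScalarTower.algebraMap_apply O (ResidueField O) A, ResidueField.algebraMap_eq,
    (dvd_iff_residue_eq_zero hπ π).1 dvd_rfl, map_zero]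

/-- The map `W(f) : W(A) → W(C)` of `W(R)`-algebras induced by a map `f : A → C` of
`R`-algebras. -/
noncomputable def wittVectorMapAlgHom (p : ℕ) [Fact p.Prime] {R A C : Type*} [CommRing R]
    [CommRing A] [CommRing C] [Algebra R A] [Algebra R C] (f : A →ₐ[R] C) :
    WittVector p A →ₐ[WittVector p R] WittVector p C :=
  { WittVector.map (f : A →+* C) with
    commutes' := fun x => WittVector.ext fun n => f.commutes (x.coeff n) }

variable (p : ℕ) [hp : Fact p.Prime] {O : Type*} [CommRing O] [IsDomain O]
  [IsDiscreteValuationRing O] [Finite (ResidueField O)] [CharP (ResidueField O) p]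
  [IsAdicComplete (maximalIdeal O) O]

variable (O) in
/-- The source `W(A) ⊗_{W(k)} O` of the comparison map `r_A`, where `k` is the residue field of
`O`. -/
abbrev WittTensor (A : Type*) [CommRing A] [Algebra (ResidueField O) A] : Type _ :=
  WittVector p A ⊗[WittVector p (ResidueField O)] O

variable (π : O) [hπ : Fact (Irreducible π)]

section Source

variable (A : Type*) [CommRing A] [Algebra (ResidueField O) A]

theorem tmul_uniformizer_dvd_natCast : (1 ⊗ₜ π : WittTensor p O A) ∣ p := by
  have h := map_dvd (Algebra.TensorProduct.includeRight :
    O →ₐ[WittVector p (ResidueField O)] WittTensor p O A) (dvd_prime hπ.out p)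
  rwa [map_natCast] at h

theorem exists_natCast_dvd_tmul_uniformizer_pow [CharZero O] :
    ∃ e : ℕ, (p : WittTensor p O A) ∣ (1 ⊗ₜ π) ^ e := by
  obtain ⟨e, he⟩ := exists_maximalIdeal_pow_eq_span_natCast O hp.out.ne_zero
  have hdvd : (p : O) ∣ π ^ e := by
    rw [← Ideal.mem_span_singleton, ← he, hπ.out.maximalIdeal_eq, Ideal.span_singleton_pow]
    exact Ideal.mem_span_singleton_self _
  have h := map_dvd (Algebra.TensorProduct.includeRight :
    O →ₐ[WittVector p (ResidueField O)] WittTensor p O A) hdvd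
  rw [map_natCast, map_pow] at h
  exact ⟨e, h⟩

theorem isHausdorff_span_tmul_uniformizer [CharZero O] [CharP A p] :
    IsHausdorff (Ideal.span {(1 ⊗ₜ π : WittTensor p O A)}) (WittTensor p O A) := by
  have := isHausdorff_wittVector (p := p) (A := A)
  have h := isHausdorff_of_free (Ideal.span {(p : WittVector p A)}) (M := WittTensor p O A)
  rw [← IsHausdorff.map_algebraMap_iff (S := WittTensor p O A),
    Ideal.map_span, Set.image_singleton, map_natCast] at h
  obtain ⟨e, he⟩ := exists_natCast_dvd_tmul_uniformizer_pow p π A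
  refine isHausdorff_of_pow_le (e := e) (J := Ideal.span {(p : WittTensor p O A)}) ?_
  rwa [Ideal.span_singleton_pow, Ideal.span_singleton_le_span_singleton]

variable {A}

theorem IsSemiperfect.isPrecomplete_span_tmul_uniformizer [CharZero O] [CharP A p]
    (hA : IsSemiperfect p A) :
    IsPrecomplete (Ideal.span {(1 ⊗ₜ π : WittTensor p O A)}) (WittTensor p O A) := by
  have := hA.isPrecomplete_wittVector
  have h := isPrecomplete_of_finite (Ideal.span {(p : WittVector p A)}) (M := WittTensor p O A)
  rw [← IsPrecomplete.map_algebraMap_iff (S := WittTensor p O A),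
    Ideal.map_span, Set.image_singleton, map_natCast] at h
  obtain ⟨e, he⟩ := exists_natCast_dvd_tmul_uniformizer_pow p π A
  refine isPrecomplete_of_pow_le (e := e) (J := Ideal.span {(p : WittTensor p O A)}) ?_ ?_
  · rw [Ideal.span_singleton_le_span_singleton]
    exact tmul_uniformizer_dvd_natCast p π A
  · rwa [Ideal.span_singleton_pow, Ideal.span_singleton_le_span_singleton]

theorem exists_dvd_sub_tmul_one (t : WittTensor p O A) :
    ∃ x : WittVector p A, 1 ⊗ₜ π ∣ t - x ⊗ₜ 1 := by
  induction t using TensorProduct.induction_on with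
  | zero => exact ⟨0, by rw [TensorProduct.zero_tmul, sub_zero]; exact dvd_zero _⟩
  | tmul x c =>
    let y := WittVector.teichmuller p (residue O c)
    obtain ⟨d, hd⟩ : π ∣ c - algebraMap (WittVector p (ResidueField O)) O y := by
      rw [dvd_iff_residue_eq_zero hπ.out, map_sub]
      exact sub_eq_zero.2 ((residue_wittToBase p O y).trans
        (WittVector.teichmuller_coeff_zero p _)).symm
    refine ⟨y • x, x ⊗ₜ d, ?_⟩
    rw [TensorProduct.smul_tmul, Algebra.smul_def, mul_one, ← TensorProduct.tmul_sub, hd,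
      Algebra.TensorProduct.tmul_mul_tmul, one_mul]
  | add s t hs ht =>
    obtain ⟨x, hx⟩ := hs
    obtain ⟨y, hy⟩ := ht
    refine ⟨x + y, ?_⟩
    rw [TensorProduct.add_tmul, add_sub_add_comm]
    exact dvd_add hx hy

end Source

variable {A : Type*} [CommRing A] [Algebra O A] [Algebra (ResidueField O) A]
  [IsScalarTower O (ResidueField O) A]

theorem greenbergToRamified_one_tmul (c : O) :
    greenbergToRamified p π A (1 ⊗ₜ c) = algebraMap O (RamifiedWittVector π A) c := by
  rw [greenbergToRamified_tmul, map_one, Algebra.algebraMap_eq_smul_one]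

theorem coeffZero_greenbergToRamified_tmul_one (x : WittVector p A) :
    RamifiedWittVector.coeffZero (greenbergToRamified p π A (x ⊗ₜ 1)) = x.coeff 0 := by
  rw [greenbergToRamified_tmul, one_smul, RamifiedWittVector.coeffZero_drinfeld]

section Semiperfect

variable [CharP A p]

theorem IsSemiperfect.greenbergToRamified_surjective [CharZero O] (hA : IsSemiperfect p A) :
    Function.Surjective (greenbergToRamified p π A) := by
  have hπA := algebraMap_uniformizer_eq_zero hπ.out A
  let I := Ideal.span {(1 ⊗ₜ π : WittTensor p O A)}
  let r := (greenbergToRamified p π A).toRingHom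
  have hI : I.map r = Ideal.span {algebraMap O (RamifiedWittVector π A) π} := by
    rw [Ideal.map_span, Set.image_singleton]
    exact congrArg (fun y => Ideal.span {y}) (greenbergToRamified_one_tmul p π π)
  have : IsPrecomplete I _ := hA.isPrecomplete_span_tmul_uniformizer p π
  have : IsHausdorff (I.map r) (RamifiedWittVector π A) :=
    hI ▸ RamifiedWittVector.isHausdorff_span_algebraMap hπA
  refine surjective_of_mk_map_comp_surjective (I := I) r fun y => ?_
  obtain ⟨y, rfl⟩ := Ideal.Quotient.mk_surjective y
  refine ⟨WittVector.teichmuller p (y.coeff 0) ⊗ₜ 1,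
    (Ideal.Quotient.mk_eq_mk_iff_sub_mem _ _).2 ?_⟩
  rw [hI, Ideal.mem_span_singleton,
    RamifiedWittVector.algebraMap_dvd_iff hπA hA.pow_residueCard_surjective, map_sub, sub_eq_zero,
    RamifiedWittVector.coeffZero_apply y, ← WittVector.teichmuller_coeff_zero p (y.coeff 0)]
  exact coeffZero_greenbergToRamified_tmul_one p π _

theorem IsSemiperfect.tmul_uniformizer_dvd (hA : IsSemiperfect p A) {t : WittTensor p O A}
    (ht : algebraMap O (RamifiedWittVector π A) π ∣ greenbergToRamified p π A t) :
    1 ⊗ₜ π ∣ t := by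
  obtain ⟨x, hx⟩ := exists_dvd_sub_tmul_one p π t
  have hrx : algebraMap O (RamifiedWittVector π A) π ∣ greenbergToRamified p π A (x ⊗ₜ 1) := by
    have h := map_dvd (greenbergToRamified p π A) hx
    rw [map_sub, greenbergToRamified_one_tmul] at h
    exact (dvd_sub_right ht).1 h
  rw [RamifiedWittVector.algebraMap_dvd_iff (algebraMap_uniformizer_eq_zero hπ.out A)
    hA.pow_residueCard_surjective, coeffZero_greenbergToRamified_tmul_one] at hrx
  have hpx : (p : WittVector p A) ∣ x := by
    simpa [hrx] using hA.natCast_pow_dvd_iff x 1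
  have hpx_tmul : (p : WittTensor p O A) ∣ x ⊗ₜ 1 := by
    have h := map_dvd (Algebra.TensorProduct.includeLeft (S := WittVector p (ResidueField O)) :
      WittVector p A →ₐ[WittVector p (ResidueField O)] WittTensor p O A) hpx
    rwa [map_natCast] at h
  exact (dvd_sub_left ((tmul_uniformizer_dvd_natCast p π A).trans hpx_tmul)).1 hx

theorem IsSemiperfect.greenbergToRamified_injective [CharZero O] [IsReduced A]
    (hA : IsSemiperfect p A) : Function.Injective (greenbergToRamified p π A) := by
  have := isHausdorff_span_tmul_uniformizer p π A
  have hπr := greenbergToRamified_one_tmul p π (A := A) π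
  refine injective_of_dvd_of_map_dvd (greenbergToRamified p π A).toRingHom (a := 1 ⊗ₜ π) ?_ ?_
  · exact hπr ▸ RamifiedWittVector.isLeftRegular_algebraMap
      (algebraMap_uniformizer_eq_zero hπ.out A)
  · exact fun t ht => hA.tmul_uniformizer_dvd p π (hπr ▸ ht)

end Semiperfect

section Functoriality

variable {C : Type*} [CommRing C] [Algebra O C] [Algebra (ResidueField O) C]
  [IsScalarTower O (ResidueField O) C]

theorem map_greenbergToRamified (f : A →ₐ[ResidueField O] C) (t : WittTensor p O A) :
    RamifiedWittVector.map (f.restrictScalars O) (greenbergToRamified p π A t) =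
      greenbergToRamified p π C ((wittVectorMapAlgHom p f).toLinearMap.rTensor O t) := by
  induction t using TensorProduct.induction_on with
  | zero => simp only [map_zero]
  | tmul x c =>
    rw [LinearMap.rTensor_tmul, greenbergToRamified_tmul, greenbergToRamified_tmul,
      RamifiedWittVector.map_smul]
    exact congrArg (c • ·) (RamifiedWittVector.drinfeldFun_map π p (f.restrictScalars O) x).symm
  | add s t hs ht => simp only [map_add, hs, ht]

theorem greenbergToRamified_injective_of_injective [CharZero O] (f : A →ₐ[ResidueField O] C)
    (hf : Function.Injective f) (hC : Function.Injective (greenbergToRamified p π C)) :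
    Function.Injective (greenbergToRamified p π A) := by
  have hWf : Function.Injective (wittVectorMapAlgHom p f).toLinearMap :=
    WittVector.map_injective (f : A →+* C) hf
  have h := hC.comp (Module.Flat.rTensor_preserves_injective_linearMap (M := O) _ hWf)
  refine .of_comp (f := RamifiedWittVector.map (f.restrictScalars O)) ?_
  convert h using 1
  exact funext (map_greenbergToRamified p π f)

end Functoriality

theorem greenbergToRamified_injective [CharZero O] (A : Type*) [CommRing A] [Algebra O A]
    [Algebra (ResidueField O) A] [IsScalarTower O (ResidueField O) A] [IsReduced A] :
    Function.Injective (greenbergToRamified p π A) := by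
  cases subsingleton_or_nontrivial A with
  | inl hA =>
    have : Subsingleton (WittVector p A) := ⟨fun x y => WittVector.ext fun _ => hA.elim _ _⟩
    have := Module.subsingleton (WittVector p A) (WittTensor p O A)
    exact Function.injective_of_subsingleton _
  | inr hA =>
    have := charP_of_injective_algebraMap (algebraMap (ResidueField O) A).injective p
    let := ((PerfectClosure.of A p).comp (algebraMap O A)).toAlgebra
    let := ((PerfectClosure.of A p).comp (algebraMap (ResidueField O) A)).toAlgebra
    have : IsScalarTower O (ResidueField O) (PerfectClosure A p) :=
      .of_algebraMap_eq fun c => congrArg (PerfectClosure.of A p)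
        (IsScalarTower.algebraMap_apply O (ResidueField O) A c)
    have hperf : IsPerfect p (PerfectClosure A p) := PerfectRing.bijective_frobenius
    exact greenbergToRamified_injective_of_injective p π
      { PerfectClosure.of A p with commutes' := fun _ => rfl } perfectClosure_of_injective
      (IsSemiperfect.greenbergToRamified_injective p π hperf.2)

theorem greenbergToRamified_surjective [CharZero O] (hA : IsSemiperfect p A) :
    Function.Surjective (greenbergToRamified p π A) := by
  cases subsingleton_or_nontrivial A with
  | inl h => exact fun y => ⟨0, RamifiedWittVector.ext (Subsingleton.elim _ _)⟩
  | inr h =>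
    have := charP_of_injective_algebraMap (algebraMap (ResidueField O) A).injective p
    exact hA.greenbergToRamified_surjective p π

theorem algebraMap_ramifiedWittVector_bijective
    (hk : Function.Bijective (algebraMap (ResidueField O) A))
    (hr : Function.Bijective (greenbergToRamified p π A)) :
    Function.Bijective (algebraMap O (RamifiedWittVector π A)) := by
  have hW : Function.Bijective (algebraMap (WittVector p (ResidueField O)) (WittVector p A)) :=
    ⟨WittVector.map_injective _ hk.1, WittVector.map_surjective _ hk.2⟩
  rw [← funext (greenbergToRamified_one_tmul p π)]
  exact hr.comp (Algebra.TensorProduct.includeRight_bijective hW)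

end Comparison

/-- For a `k`-algebra `A` (an `O`-algebra whose structure map factors through the residue field `k`
of `O`), the map `r_A : W(A) ⊗_{W(k)} O → W_O(A)` is injective, surjective, bijective if `A` is
reduced, semiperfect, perfect, respectively; moreover `O → W_O(k)` is an isomorphism. -/
theorem lemma5p1 {O : Type*} [CommRing O] [IsDomain O] [IsDiscreteValuationRing O] [CharZero O]
    [IsAdicComplete (IsLocalRing.maximalIdeal O) O] [Finite (IsLocalRing.ResidueField O)]
    (p : ℕ) [Fact p.Prime] [CharP (IsLocalRing.ResidueField O) p]
    (π : O) [Fact (Irreducible π)] :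
    (∀ (A : Type*) [CommRing A] [Algebra O A] [Algebra (IsLocalRing.ResidueField O) A]
        [IsScalarTower O (IsLocalRing.ResidueField O) A],
      (IsReduced A → Function.Injective (greenbergToRamified p π A)) ∧
      (IsSemiperfect p A → Function.Surjective (greenbergToRamified p π A)) ∧
      (IsPerfect p A → Function.Bijective (greenbergToRamified p π A))) ∧
    Function.Bijective
      (algebraMap O (RamifiedWittVector π (IsLocalRing.ResidueField O))) := by
  have hk : IsPerfect p (ResidueField O) := PerfectRing.bijective_frobenius
  refine ⟨fun A _ _ _ _ => ⟨fun _ => greenbergToRamified_injective p π A,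
    greenbergToRamified_surjective p π, fun hA => ?_⟩, ?_⟩
  · have := hA.isReduced
    exact ⟨greenbergToRamified_injective p π A, greenbergToRamified_surjective p π hA.2⟩
  · exact algebraMap_ramifiedWittVector_bijective p π Function.bijective_id
      ⟨greenbergToRamified_injective p π _, greenbergToRamified_surjective p π hk.2⟩
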